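/- For $z\in\mathbb{C}$ let $[z]=\lfloor \mathrm{Re}(z)+\tfrac12\rfloor+i\lfloor \mathrm{Im}(z)+\tfrac12\rfloor$, let $\mathfrak F=\{z\in\mathbb C: -\tfrac12\le \mathrm{Re}(z)<\tfrac12,\ -\tfrac12\le \mathrm{Im}(z)<\tfrac12\}$, and let $\overline{\mathfrak F}$ be its closure. Let $T:\mathfrak F\to\mathfrak F$ be given by $T(0)=0$ and $T(z)=z^{-1}-[z^{-1}]$ for $z\neq0$, and let $a_n(z)=[1/T^{n-1}(z)]$ whenever $T^{n-1}(z)\ne0$ ($n\ge1$); for $z\in\mathfrak F\setminus\mathbb Q(i)$ the sequence $(a_n(z))_{n\ge1}$ is the Hurwitz expansion of $z$. The cylinder of a word $(b_1,\dots,b_m)\in\mathbb Z[i]^m$ is $\mathcal C_m(b_1,\dots,b_m)=\{z\in\mathfrak F: a_1(z)=b_1,\dots,a_m(z)=b_m\}$. A word is regular if its cylinder has nonempty interior, and irregular if its cylinder is nonempty with empty interior. Let $\overline{\mathsf R}$ be the set of sequences $(a_n)_{n\ge1}$ in $\mathbb Z[i]$ such that $(a_1,\dots,a_n)$ is regular for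 every $n\ge1$. Write $[0;a_1,\dots,a_n]=\cfrac{1}{a_1+\cfrac{1}{\ddots+\cfrac{1}{a_n}}}$. Theorem. (1) For every $\mathbf a\in\overline{\mathsf R}$ the finite continued fractions $[0;a_1,\dots,a_n]$ are well defined (no denominator vanishes) and converge; put $\overline\Lambda(\mathbf a)=\lim_{n\to\infty}[0;a_1,\dots,a_n]$. (2) $\overline\Lambda(\overline{\mathsf R})=\overline{\mathfrak F}\setminus\mathbb Q(i)$. (3) Let $z\in\mathfrak F\setminus\mathbb Q(i)$ have a Hurwitz expansion $\mathbf a$ with at least one irregular prefix. Put $\mathbf b_0=\mathbf a$ and define $\mathbf b_{N+1}$ from $\mathbf b_N$ for $N=0,1,2,\dots$ as follows. If there is $j\ge1$ such that the prefix of $\mathbf b_N$ of length $j$ is regular and the prefix of length $j+1$ is not, take the least such $j$ and let $c$ be the term number $j+1$ of $\mathbf b_N$. The first $j$ terms of $\mathbf b_{N+1}$ are those of $\mathbf b_N$. If $c=m\pm i$ with $m\in\mathbb Z$, $|m|\ge2$, the term number $j+1$ of $\mathbf b_{N+1}$ is $m$ and all later terms are the images of those of $\mathbf b_N$ under $w\mapsto\overline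 w$; if $c=\pm1+im$ with $m\in\mathbb Z$, $|m|\ge2$, the term number $j+1$ is $im$ and all later terms are the images of those of $\mathbf b_N$ under $w\mapsto-\overline w$. If there is no such $j$, put $\mathbf b_{N+1}=\mathbf b_N$. Then for every $N$ for which $j$ exists, $c$ has one of these two forms; the sequences $\mathbf b_N$ converge termwise (each term is eventually constant) to a sequence $\mathbf b\in\overline{\mathsf R}$; and $\overline\Lambda(\mathbf b)=z$. -/

import Mathlib

open Filter Topology

noncomputable section

namespace HurwitzCF

/-! Sequences `(a₁, a₂, …)` of Gaussian integers are functions `a : ℕ → GaussianInt`; the term `aₙ`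
of the mathematics is `a (n - 1)`, so `a 0` is the first term. -/

/-- The half-open unit square centred at the origin. -/
def square : Set ℂ :=
  {z | -(1 / 2 : ℝ) ≤ z.re ∧ z.re < 1 / 2 ∧ -(1 / 2 : ℝ) ≤ z.im ∧ z.im < 1 / 2}

/-- The field `ℚ(i)` of Gaussian rationals, as a subset of `ℂ`. -/
def gaussianRationals : Set ℂ :=
  {z | ∃ x y : ℚ, z = (x : ℂ) + (y : ℂ) * Complex.I}

/-- The nearest Gaussian integer `[z]` (ties are broken towards larger real and imaginary part). -/
def nearest (z : ℂ) : GaussianInt :=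
  ⟨⌊z.re + 1 / 2⌋, ⌊z.im + 1 / 2⌋⟩

/-- The complex Gauss map. -/
def gaussMap (z : ℂ) : ℂ :=
  if z = 0 then 0 else z⁻¹ - (nearest z⁻¹ : ℂ)

/-- `partialQuotient z k` is the partial quotient `a_{k+1}(z) = [1 / T^k(z)]` of the Hurwitz
continued fraction of `z`; it is meaningful only when `T^k(z) ≠ 0`. -/
def partialQuotient (z : ℂ) (k : ℕ) : GaussianInt :=
  nearest ((gaussMap^[k] z)⁻¹)

/-- The cylinder based on the word `b`: the points of the square whose first `m` partial quotients
exist and are the letters of `b`. -/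
def cylinder {m : ℕ} (b : Fin m → GaussianInt) : Set ℂ :=
  {z | z ∈ square ∧ ∀ k : Fin m, gaussMap^[(k : ℕ)] z ≠ 0 ∧ partialQuotient z k = b k}

/-- A word is regular when its cylinder has nonempty interior. -/
def RegularWord {m : ℕ} (b : Fin m → GaussianInt) : Prop :=
  (interior (cylinder b)).Nonempty

/-- A word is irregular when its cylinder is nonempty but has empty interior. -/
def IrregularWord {m : ℕ} (b : Fin m → GaussianInt) : Prop :=
  (cylinder b).Nonempty ∧ interior (cylinder b) = ∅

/-- The prefix of length `n` of a sequence. -/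
def pref (a : ℕ → GaussianInt) (n : ℕ) : Fin n → GaussianInt :=
  fun k => a k

/-- The sequences all of whose nonempty finite prefixes are regular. -/
def Rbar : Set (ℕ → GaussianInt) :=
  {a | ∀ n : ℕ, 1 ≤ n → RegularWord (pref a n)}

/-- The finite continued fraction `[0; b₁, …, bₙ] = 1 / (b₁ + 1 / (b₂ + ⋯ + 1 / bₙ))`. -/
def cfValue : (n : ℕ) → (Fin n → GaussianInt) → ℂ
  | 0, _ => 0
  | n + 1, b => 1 / ((b 0 : ℂ) + cfValue n (Fin.tail b))

/-- No denominator occurring in the nested fraction `[0; b₁, …, bₙ]` vanishes. -/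
def CFDefined : (n : ℕ) → (Fin n → GaussianInt) → Prop
  | 0, _ => True
  | n + 1, b => (b 0 : ℂ) + cfValue n (Fin.tail b) ≠ 0 ∧ CFDefined n (Fin.tail b)

/-- The convergents `[0; a₁, …, aₙ]` of a sequence. -/
def convergent (a : ℕ → GaussianInt) (n : ℕ) : ℂ :=
  cfValue n (pref a n)

/-- The map `a ↦ lim [0; a₁, …, aₙ]`. -/
def LambdaBar (a : ℕ → GaussianInt) : ℂ :=
  limUnder atTop (convergent a)

/-! ### The algorithm -/

/-- `a = m + i` or `a = m - i` for an integer `m` with `|m| ≥ 2`. -/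
def IsHorizontal (a : GaussianInt) : Prop :=
  2 ≤ |a.re| ∧ |a.im| = 1

/-- `a = 1 + i m` or `a = -1 + i m` for an integer `m` with `|m| ≥ 2`. -/
def IsVertical (a : GaussianInt) : Prop :=
  |a.re| = 1 ∧ 2 ≤ |a.im|

/-- The reflection `z ↦ conj z`, on Gaussian integers. -/
def mirror₁ (a : GaussianInt) : GaussianInt := ⟨a.re, -a.im⟩

/-- The reflection `z ↦ - conj z`, on Gaussian integers. -/
def mirror₂ (a : GaussianInt) : GaussianInt := ⟨-a.re, a.im⟩

open Classical in
/-- The digit correction: `S (m ± i) = m` and `S (±1 + i m) = i m`, for `|m| ≥ 2`. Other Gaussian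
integers are not in the domain of `S`; they are left unchanged here. -/
def S (a : GaussianInt) : GaussianInt :=
  if IsHorizontal a then ⟨a.re, 0⟩ else if IsVertical a then ⟨0, a.im⟩ else a

open Classical in
/-- The reflection that goes with the correction of the digit `a`. -/
def mirrorFor (a : GaussianInt) : GaussianInt → GaussianInt :=
  if IsHorizontal a then mirror₁ else if IsVertical a then mirror₂ else id

/-- The prefix of length `j ≥ 1` of `b` is regular and the prefix of length `j + 1` is not. -/
def IsBreak (b : ℕ → GaussianInt) (j : ℕ) : Prop :=
  1 ≤ j ∧ RegularWord (pref b j) ∧ ¬ RegularWord (pref b (j + 1))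

/-- Keep the first `j` terms, replace the term number `j + 1` (which is `b j`) by its correction,
and reflect all later terms. -/
def correctAt (b : ℕ → GaussianInt) (j : ℕ) : ℕ → GaussianInt :=
  fun l => if l < j then b l else if l = j then S (b j) else mirrorFor (b j) (b l)

open Classical in
/-- One iteration of the algorithm: correct at the (first, in fact only) break, if there is one. -/
def algStep (b : ℕ → GaussianInt) : ℕ → GaussianInt :=
  if h : ∃ j, IsBreak b j then correctAt b (Nat.find h) else b

/-- The sequence obtained after `N` iterations of the algorithm. -/
def algIter (a : ℕ → GaussianInt) (N : ℕ) : ℕ → GaussianInt :=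
  algStep^[N] a

end HurwitzCF

end

/-!
The proof rests on a finite automaton that decides regularity. Inversion maps the sides of the
square to the unit circles centred at the units of `ℤ[i]`, it maps these circles (they pass through
the origin) to the lines `Re (c w) = 1 / 2` with `c` a unit, and it maps the unit circle centred at
`c` with `|c|² = 2` to the one centred at `conj c`. Hence, after any word, the points that can still
occur form the square minus some unit discs centred at Gaussian integers; the set of these centres
is the *state*. A digit may follow a state when it is not `0`, does not produce a disc centred at
the origin, and lies on the right side of the lines (`Allowed`). In the presence of these conditions
the remaining open region is never empty, so a word is regular exactly when its digits are
successively allowed (`regularWord_iff`).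

The closed regions of the states are mapped into each other by the inverse branches
`u ↦ 1 / (u + d)`, which contract distances by `1 / 2` because `|z|² ≤ 1 / 2` on the square. So
convergents of admissible sequences are defined and converge, and the tails of the limit are nonzero
points of the closed square; for a Gaussian rational they would give an infinite descent
(`IsOrbit.not_mem_gaussianRationals`). Conversely, an irrational point of a closed region always has
an allowed digit with remainder in the closed square: the state forbids one side of a line
`Re (c w) = 1 / 2` only, never two opposite ones, and a tie may be rounded to the other side
(`exists_allowed`).

For the algorithm, a digit of an orbit in the closed square can fail to be allowed only if the
inverse lies on such a line and was rounded to the wrong side (`tie_of_not_allowed`). The digit then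
has the form `±1 + i m` or `m ± i` with `|m| ≥ 2`, and correcting it replaces the remainder by its
mirror image in an axis. Since reflections commute with inversion, reflecting the later digits gives
an orbit of the same point that is admissible one step further (`correctAt_spec`). So the breaks move
to infinity and the limit sequence is admissible with the same value.
-/

open Filter Topology

noncomputable section

namespace HurwitzCF

/-! ### Discs, states and regions -/

/-- `P` is one of the two half-lines of nonnegative or of positive reals; the conditions that define
closed and open regions then read `x ∈ P`. -/
structure IsPositivity (P : Set ℝ) : Prop where
  mul_iff : ∀ x t : ℝ, 0 < t → (x * t ∈ P ↔ x ∈ P)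
  add_mem : ∀ x t : ℝ, x ∈ P → 0 ≤ t → x + t ∈ P
  pos_mem : ∀ x : ℝ, 0 < x → x ∈ P
  nonneg : ∀ x ∈ P, 0 ≤ x

lemma isPositivity_Ici : IsPositivity (Set.Ici 0) where
  mul_iff _ _ ht := mul_nonneg_iff_of_pos_right ht
  add_mem _ _ hx ht := add_nonneg hx ht
  pos_mem _ hx := le_of_lt hx
  nonneg _ hx := hx

lemma isPositivity_Ioi : IsPositivity (Set.Ioi 0) where
  mul_iff _ _ ht := mul_pos_iff_of_pos_right ht
  add_mem _ _ hx ht := add_pos_of_pos_of_nonneg hx ht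
  pos_mem _ hx := hx
  nonneg _ hx := le_of_lt hx

/-- The unit square (open or closed according to `P`) with the unit discs centred at the points of
`D` removed (closed or open discs, respectively). The square is cut out by the four half-planes
`Re (c z) ≤ 1 / 2` or `Re (c z) < 1 / 2`, where `c` is a unit. -/
def region (P : Set ℝ) (D : Set GaussianInt) : Set ℂ :=
  {z | (∀ c : GaussianInt, c.norm = 1 → 1 - 2 * ((c : ℂ) * z).re ∈ P) ∧
    ∀ c ∈ D, Complex.normSq (z - c) - 1 ∈ P}

/-- The closed region of the state `D`. -/
abbrev closedRegion (D : Set GaussianInt) : Set ℂ := region (Set.Ici 0) D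

/-- The open region of the state `D`. -/
abbrev openRegion (D : Set GaussianInt) : Set ℂ := region (Set.Ioi 0) D

/-- The state after the digit `d`: inversion turns the sides of the square into the unit circles
centred at the units, and the unit circle centred at `c` with `|c|² = 2` into the one centred at
`conj c`; then everything is translated by `-d`. -/
def next (D : Set GaussianInt) (d : GaussianInt) : Set GaussianInt :=
  {e | (e + d).norm = 1 ∨ ((e + d).norm = 2 ∧ star (e + d) ∈ D)}

/-- The digit `d` may follow the state `D`. The last condition comes from the circles through the
origin, which inversion turns into the lines `Re (c w) = 1 / 2`. -/
def Allowed (D : Set GaussianInt) (d : GaussianInt) : Prop :=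
  d ≠ 0 ∧ 0 ∉ next D d ∧ ∀ c ∈ D, c.norm = 1 → (c * d).re ≤ 0

lemma norm_eq (c : GaussianInt) : c.norm = c.re * c.re + c.im * c.im := by
  simp [Zsqrtd.norm_def]

lemma unit_cases {c : GaussianInt} (h : c.norm = 1) :
    c = ⟨1, 0⟩ ∨ c = ⟨-1, 0⟩ ∨ c = ⟨0, 1⟩ ∨ c = ⟨0, -1⟩ := by
  rw [norm_eq] at h
  obtain ⟨x, y⟩ := c
  simp only [Zsqrtd.mk.injEq] at *
  have h1 : x ≤ 1 := by nlinarith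
  have h2 : -1 ≤ x := by nlinarith
  have h3 : y ≤ 1 := by nlinarith
  have h4 : -1 ≤ y := by nlinarith
  interval_cases x <;> interval_cases y <;> simp_all

lemma normSq_coe_sub (z : ℂ) (c : GaussianInt) :
    Complex.normSq (z - c) = (z.re - c.re) ^ 2 + (z.im - c.im) ^ 2 := by
  simp [Complex.normSq_apply]; ring

lemma re_coe_mul (z : ℂ) (c : GaussianInt) : ((c : ℂ) * z).re = c.re * z.re - c.im * z.im := by
  simp

lemma norm_cast_real {c : GaussianInt} {n : ℤ} (h : c.norm = n) :
    (c.re : ℝ) ^ 2 + (c.im : ℝ) ^ 2 = n := by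
  rw [← h, norm_eq]; push_cast; ring

lemma region_bounds {P : Set ℝ} (hP : IsPositivity P) {D : Set GaussianInt} {z : ℂ}
    (hz : z ∈ region P D) : |z.re| ≤ 1 / 2 ∧ |z.im| ≤ 1 / 2 := by
  have h1 := hP.nonneg _ (hz.1 ⟨1, 0⟩ (by simp [norm_eq]))
  have h2 := hP.nonneg _ (hz.1 ⟨-1, 0⟩ (by simp [norm_eq]))
  have h3 := hP.nonneg _ (hz.1 ⟨0, 1⟩ (by simp [norm_eq]))
  have h4 := hP.nonneg _ (hz.1 ⟨0, -1⟩ (by simp [norm_eq]))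
  simp only [re_coe_mul] at h1 h2 h3 h4
  push_cast at h1 h2 h3 h4
  constructor <;> rw [abs_le] <;> constructor <;> linarith

lemma mem_closedRegion_empty {z : ℂ} :
    z ∈ closedRegion ∅ ↔ |z.re| ≤ 1 / 2 ∧ |z.im| ≤ 1 / 2 := by
  refine ⟨region_bounds isPositivity_Ici, fun ⟨h1, h2⟩ => ⟨fun c hc => ?_, by simp⟩⟩
  rw [abs_le] at h1 h2
  rw [Set.mem_Ici, re_coe_mul]
  rcases unit_cases hc with rfl | rfl | rfl | rfl <;> push_cast <;> linarith

lemma mem_openRegion_empty {z : ℂ} :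
    z ∈ openRegion ∅ ↔ (-(1 / 2) < z.re ∧ z.re < 1 / 2) ∧ (-(1 / 2) < z.im ∧ z.im < 1 / 2) := by
  refine ⟨fun hz => ?_, fun ⟨h1, h2⟩ => ⟨fun c hc => ?_, by simp⟩⟩
  · have h1 := hz.1 ⟨1, 0⟩ (by simp [norm_eq])
    have h2 := hz.1 ⟨-1, 0⟩ (by simp [norm_eq])
    have h3 := hz.1 ⟨0, 1⟩ (by simp [norm_eq])
    have h4 := hz.1 ⟨0, -1⟩ (by simp [norm_eq])
    rw [Set.mem_Ioi, re_coe_mul] at h1 h2 h3 h4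
    push_cast at h1 h2 h3 h4
    refine ⟨⟨?_, ?_⟩, ?_, ?_⟩ <;> linarith
  · rw [Set.mem_Ioi, re_coe_mul]
    rcases unit_cases hc with rfl | rfl | rfl | rfl <;> push_cast <;> linarith

lemma region_mono (P : Set ℝ) {D E : Set GaussianInt} (h : D ⊆ E) : region P E ⊆ region P D :=
  fun _ hz => ⟨hz.1, fun c hc => hz.2 c (h hc)⟩

lemma openRegion_subset (D : Set GaussianInt) : openRegion D ⊆ closedRegion D :=
  fun _ hz => ⟨fun c hc => Set.mem_Ici.2 (le_of_lt (hz.1 c hc)), fun c hc => Set.mem_Ici.2 (le_of_lt (hz.2 c hc))⟩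

lemma normSq_le_half {P : Set ℝ} (hP : IsPositivity P) {D : Set GaussianInt} {z : ℂ}
    (hz : z ∈ region P D) : Complex.normSq z ≤ 1 / 2 := by
  obtain ⟨h1, h2⟩ := region_bounds hP hz
  rw [Complex.normSq_apply]
  rw [abs_le] at h1 h2
  nlinarith

lemma norm_sq_le_half {P : Set ℝ} (hP : IsPositivity P) {D : Set GaussianInt} {z : ℂ}
    (hz : z ∈ region P D) : ‖z‖ ^ 2 ≤ 1 / 2 := by
  rw [← Complex.normSq_eq_norm_sq]
  exact normSq_le_half hP hz

/-! ### Inversion -/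

lemma re_unit_mul_inv {w : ℂ} (hw : w ≠ 0) {c : GaussianInt} (hc : c.norm = 1) :
    (1 - 2 * ((c : ℂ) * w⁻¹).re) * Complex.normSq w = Complex.normSq (w - c) - 1 := by
  have hN : Complex.normSq w ≠ 0 := by simpa using hw
  have h := norm_cast_real hc
  rw [normSq_coe_sub, re_coe_mul, Complex.inv_re, Complex.inv_im]
  field_simp
  rw [Complex.normSq_apply]
  push_cast at h
  linear_combination -h

lemma normSq_inv_sub_unit {w : ℂ} (hw : w ≠ 0) {c : GaussianInt} (hc : c.norm = 1) :
    (Complex.normSq (w⁻¹ - c) - 1) * Complex.normSq w = 1 - 2 * ((c : ℂ) * w).re := by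
  have hN : Complex.normSq w ≠ 0 := by simpa using hw
  have h := norm_cast_real hc
  rw [normSq_coe_sub, re_coe_mul, Complex.inv_re, Complex.inv_im]
  field_simp
  rw [Complex.normSq_apply] at *
  push_cast at h
  linear_combination (w.re * w.re + w.im * w.im) ^ 2 * h

lemma normSq_inv_sub_diag {w : ℂ} (hw : w ≠ 0) {c : GaussianInt} (hc : c.norm = 2) :
    (Complex.normSq (w⁻¹ - c) - 1) * Complex.normSq w =
      Complex.normSq (w - (star c : GaussianInt)) - 1 := by
  have hN : Complex.normSq w ≠ 0 := by simpa using hw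
  have h := norm_cast_real hc
  rw [normSq_coe_sub, normSq_coe_sub, Complex.inv_re, Complex.inv_im]
  simp only [Zsqrtd.re_star, Zsqrtd.im_star]
  field_simp
  rw [Complex.normSq_apply] at *
  push_cast at *
  linear_combination ((w.re * w.re + w.im * w.im) ^ 2 - (w.re * w.re + w.im * w.im)) * h

/-- Discs centred at Gaussian integers of norm greater than `2` do not meet the closed square. -/
lemma one_lt_normSq_of_far {z : ℂ} {c : GaussianInt} (h1 : |z.re| ≤ 1 / 2) (h2 : |z.im| ≤ 1 / 2)
    (hc : 2 < c.norm) : 0 < Complex.normSq (z - c) - 1 := by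
  rw [normSq_coe_sub]
  have h : (2 : ℝ) < (c.re : ℝ) ^ 2 + (c.im : ℝ) ^ 2 := by
    rw [norm_cast_real rfl]; exact_mod_cast hc
  rw [norm_eq] at hc
  rw [abs_le] at h1 h2
  have key : 2 ≤ c.re ∨ c.re ≤ -2 ∨ 2 ≤ c.im ∨ c.im ≤ -2 := by
    by_contra! hcon
    nlinarith
  rcases key with k | k | k | k
  · have : (2 : ℝ) ≤ c.re := by exact_mod_cast k
    nlinarith [sq_nonneg (z.im - c.im)]
  · have : (c.re : ℝ) ≤ -2 := by exact_mod_cast k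
    nlinarith [sq_nonneg (z.im - c.im)]
  · have : (2 : ℝ) ≤ c.im := by exact_mod_cast k
    nlinarith [sq_nonneg (z.re - c.re)]
  · have : (c.im : ℝ) ≤ -2 := by exact_mod_cast k
    nlinarith [sq_nonneg (z.re - c.re)]

/-- The Gauss map carries the region of a state into the region of the next state. -/
lemma inv_sub_mem_region {P : Set ℝ} (hP : IsPositivity P) {D : Set GaussianInt} {z : ℂ}
    {d : GaussianInt} (hz : z ∈ region P D) (h0 : z ≠ 0) (hu : z⁻¹ - d ∈ region P ∅) :
    z⁻¹ - d ∈ region P (next D d) := by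
  have hw : z⁻¹ ≠ 0 := inv_ne_zero h0
  have hN : 0 < Complex.normSq z⁻¹ := by simpa using h0
  refine ⟨hu.1, fun e he => ?_⟩
  have hsub : z⁻¹ - (d : ℂ) - e = z⁻¹ - ((e + d : GaussianInt) : ℂ) := by
    rw [GaussianInt.toComplex_add]; ring
  rw [hsub]
  rcases he with he | ⟨he, hD⟩
  · rw [← re_unit_mul_inv hw he, hP.mul_iff _ _ hN, inv_inv]
    exact hz.1 _ he
  · have hs : (star (e + d)).norm = 2 := by rw [Zsqrtd.norm_conj, he]
    have := normSq_inv_sub_diag hw hs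
    rw [star_star, inv_inv] at this
    rw [← this, hP.mul_iff _ _ hN]
    exact hz.2 _ hD

lemma add_ne_zero_of_bounds {u : ℂ} {d : GaussianInt} (h1 : |u.re| ≤ 1 / 2) (h2 : |u.im| ≤ 1 / 2)
    (hd : d ≠ 0) : u + d ≠ 0 := by
  intro h
  apply hd
  have hr := congrArg Complex.re h
  have hi := congrArg Complex.im h
  simp only [Complex.add_re, Complex.add_im, ← GaussianInt.intCast_re, ← GaussianInt.intCast_im,
    Complex.zero_re, Complex.zero_im] at hr hi
  rw [abs_le] at h1 h2
  have a1 : (d.re : ℝ) < 1 := by linarith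
  have a2 : (-1 : ℝ) < d.re := by linarith
  have a3 : (d.im : ℝ) < 1 := by linarith
  have a4 : (-1 : ℝ) < d.im := by linarith
  norm_cast at a1 a3
  have a2' : -1 < d.re := by exact_mod_cast a2
  have a4' : -1 < d.im := by exact_mod_cast a4
  ext
  · change d.re = 0; omega
  · change d.im = 0; omega

/-- The inverse branch of an allowed digit carries the region of the next state into the region of
the present one. -/
lemma inv_add_mem_region {P : Set ℝ} (hP : IsPositivity P) {D : Set GaussianInt} {u : ℂ}
    {d : GaussianInt} (hd : Allowed D d) (hD : 0 ∉ D) (hu : u ∈ region P (next D d)) :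
    (u + d)⁻¹ ∈ region P D := by
  obtain ⟨b1, b2⟩ := region_bounds hP hu
  have hw : u + d ≠ 0 := add_ne_zero_of_bounds b1 b2 hd.1
  have hN : 0 < Complex.normSq (u + d) := Complex.normSq_pos.2 hw
  have hsq : ∀ c : GaussianInt, c.norm = 1 → 1 - 2 * ((c : ℂ) * (u + d)⁻¹).re ∈ P := by
    intro c hc
    rw [← hP.mul_iff _ _ hN, re_unit_mul_inv hw hc]
    have := hu.2 (c - d) (Or.inl (by simpa using hc))
    convert this using 3
    rw [GaussianInt.toComplex_sub]; ring
  have hsq' : (u + d)⁻¹ ∈ region P ∅ := ⟨hsq, by simp⟩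
  refine ⟨hsq, fun c hc => ?_⟩
  have hn0 : 0 ≤ c.norm := GaussianInt.norm_nonneg _
  have hn1 : c.norm ≠ 0 := fun h => hD (GaussianInt.norm_eq_zero.1 h ▸ hc)
  by_cases h1 : c.norm = 1
  · rw [← hP.mul_iff _ _ hN, normSq_inv_sub_unit hw h1]
    have hr : (((c * d).re : ℤ) : ℝ) ≤ 0 := by exact_mod_cast hd.2.2 c hc h1
    have := hP.add_mem _ (-(2 * ((c * d).re : ℤ) : ℝ)) (hu.1 c h1) (by linarith)
    convert this using 1
    rw [GaussianInt.intCast_re, GaussianInt.toComplex_mul, mul_add, Complex.add_re]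
    ring
  · by_cases h2 : c.norm = 2
    · rw [← hP.mul_iff _ _ hN, normSq_inv_sub_diag hw h2]
      have := hu.2 (star c - d) (Or.inr ⟨by simpa [Zsqrtd.norm_conj] using h2, by simpa using hc⟩)
      convert this using 3
      rw [GaussianInt.toComplex_sub]; ring
    · obtain ⟨g1, g2⟩ := region_bounds hP hsq'
      exact hP.pos_mem _ (one_lt_normSq_of_far g1 g2 (by omega))

/-- Two of the three conditions on an allowed digit hold for every digit that leaves a remainder in
the closed square. -/
lemma digit_conditions {D : Set GaussianInt} {z : ℂ} {d : GaussianInt} (hz : z ∈ closedRegion D)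
    (h0 : z ≠ 0) (hu : z⁻¹ - d ∈ closedRegion ∅) : d ≠ 0 ∧ 0 ∉ next D d := by
  constructor
  · rintro rfl
    have h1 := normSq_le_half isPositivity_Ici hz
    have h2 := normSq_le_half isPositivity_Ici hu
    have h3 := Complex.normSq_pos.2 h0
    have h4 : Complex.normSq z⁻¹ * Complex.normSq z = 1 := by
      rw [← map_mul, inv_mul_cancel₀ h0, map_one]
    simp only [GaussianInt.toComplex_zero, sub_zero] at h2
    nlinarith
  · intro h
    have h1 := (inv_sub_mem_region isPositivity_Ici hz h0 hu).2 0 h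
    have h2 := normSq_le_half isPositivity_Ici hu
    simp only [GaussianInt.toComplex_zero, sub_zero, Set.mem_Ici] at h1
    linarith

lemma allowed_of_openRegion {D : Set GaussianInt} {z : ℂ} {d : GaussianInt} (hz : z ∈ openRegion D)
    (h0 : z ≠ 0) (hu : z⁻¹ - d ∈ openRegion ∅) : Allowed D d := by
  obtain ⟨h1, h2⟩ := digit_conditions (openRegion_subset _ hz) h0 (openRegion_subset _ hu)
  refine ⟨h1, h2, fun c hc hn => ?_⟩
  have hw : z⁻¹ ≠ 0 := inv_ne_zero h0
  have hN : 0 < Complex.normSq z⁻¹ := by simpa using h0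
  have h3 := hz.2 c hc
  have e3 := normSq_inv_sub_unit hw hn
  rw [inv_inv] at e3
  rw [← isPositivity_Ioi.mul_iff _ _ hN, e3, Set.mem_Ioi] at h3
  have h4 := hu.1 (-c) (by simpa using hn)
  rw [Set.mem_Ioi] at h4
  have : (((c * d).re : ℤ) : ℝ) < 1 := by
    rw [GaussianInt.intCast_re, GaussianInt.toComplex_mul]
    rw [GaussianInt.toComplex_neg, mul_sub, Complex.sub_re, neg_mul, neg_mul, Complex.neg_re, Complex.neg_re] at h4
    linarith
  have : (c * d).re < 1 := by exact_mod_cast this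
  omega

/-- The centres of the removed discs never include the origin or two opposite units. -/
def Good (D : Set GaussianInt) : Prop :=
  0 ∉ D ∧ ¬ ((⟨1, 0⟩ : GaussianInt) ∈ D ∧ (⟨-1, 0⟩ : GaussianInt) ∈ D) ∧
    ¬ ((⟨0, 1⟩ : GaussianInt) ∈ D ∧ (⟨0, -1⟩ : GaussianInt) ∈ D)

lemma good_empty : Good ∅ := by simp [Good]

lemma good_next {D : Set GaussianInt} {d : GaussianInt} (hd : Allowed D d) : Good (next D d) := by
  -- By the parallelogram law, opposite units in the next state force `|d|² ≤ 1`.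
  have hn : 1 < d.norm := by
    have h0 : 0 ≤ d.norm := GaussianInt.norm_nonneg _
    have h1 : d.norm ≠ 0 := fun h => hd.1 (GaussianInt.norm_eq_zero.1 h)
    have h2 : d.norm ≠ 1 := fun h => hd.2.1 (Or.inl (by simpa using h))
    omega
  rw [norm_eq] at hn
  have hle : ∀ e ∈ next D d, (e.re + d.re) * (e.re + d.re) + (e.im + d.im) * (e.im + d.im) ≤ 2 := by
    intro e he
    have : (e + d).norm ≤ 2 := by rcases he with he | he <;> omega
    simpa [norm_eq] using this
  refine ⟨hd.2.1, fun ⟨h1, h2⟩ => ?_, fun ⟨h1, h2⟩ => ?_⟩ <;>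
  · have := hle _ h1
    have := hle _ h2
    dsimp only at *
    nlinarith

lemma zero_mem_closedRegion {D : Set GaussianInt} (hD : 0 ∉ D) : (0 : ℂ) ∈ closedRegion D := by
  refine ⟨fun c _ => by simp, fun c hc => ?_⟩
  have h0 : 0 ≤ c.norm := GaussianInt.norm_nonneg _
  have h1 : c.norm ≠ 0 := fun h =>
    hD (GaussianInt.norm_eq_zero.1 h ▸ hc)
  have h2 : (1 : ℝ) ≤ c.norm := by
    have : 1 ≤ c.norm := by omega
    exact_mod_cast this
  rw [normSq_coe_sub, Set.mem_Ici]
  have := norm_cast_real (c := c) rfl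
  simp only [Complex.zero_re, Complex.zero_im]
  nlinarith

open Classical in
lemma openRegion_nonempty {D : Set GaussianInt} (hD : Good D) : (openRegion D).Nonempty := by
  -- A point near the origin, on the far side of the removed discs that touch the origin.
  obtain ⟨x, hx, hx1, hx2⟩ : ∃ x : ℝ, x ^ 2 = 1 / 100 ∧
      ((⟨1, 0⟩ : GaussianInt) ∈ D → x < 0) ∧ ((⟨-1, 0⟩ : GaussianInt) ∈ D → 0 < x) := by
    by_cases h : (⟨1, 0⟩ : GaussianInt) ∈ D
    · exact ⟨-(1 / 10), by norm_num, fun _ => by norm_num, fun h' => absurd ⟨h, h'⟩ hD.2.1⟩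
    · exact ⟨1 / 10, by norm_num, fun h' => absurd h' h, fun _ => by norm_num⟩
  obtain ⟨y, hy, hy1, hy2⟩ : ∃ x : ℝ, x ^ 2 = 1 / 100 ∧
      ((⟨0, 1⟩ : GaussianInt) ∈ D → x < 0) ∧ ((⟨0, -1⟩ : GaussianInt) ∈ D → 0 < x) := by
    by_cases h : (⟨0, 1⟩ : GaussianInt) ∈ D
    · exact ⟨-(1 / 10), by norm_num, fun _ => by norm_num, fun h' => absurd ⟨h, h'⟩ hD.2.2⟩
    · exact ⟨1 / 10, by norm_num, fun h' => absurd h' h, fun _ => by norm_num⟩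
  have bx1 : x ≤ 1 / 10 := by nlinarith
  have bx2 : -(1 / 10) ≤ x := by nlinarith
  have by1 : y ≤ 1 / 10 := by nlinarith
  have by2 : -(1 / 10) ≤ y := by nlinarith
  have hsq : (⟨x, y⟩ : ℂ) ∈ openRegion ∅ :=
    mem_openRegion_empty.2 ⟨⟨by simp; linarith, by simp; linarith⟩, by simp; linarith,
      by simp; linarith⟩
  refine ⟨⟨x, y⟩, hsq.1, fun c hc => ?_⟩
  have h0 : 0 ≤ c.norm := GaussianInt.norm_nonneg _
  have h1 : c.norm ≠ 0 := fun h =>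
    hD.1 (GaussianInt.norm_eq_zero.1 h ▸ hc)
  rw [Set.mem_Ioi, normSq_coe_sub]
  dsimp only
  by_cases hn : c.norm = 1
  · rcases unit_cases hn with rfl | rfl | rfl | rfl
    · have := hx1 hc; push_cast; nlinarith
    · have := hx2 hc; push_cast; nlinarith
    · have := hy1 hc; push_cast; nlinarith
    · have := hy2 hc; push_cast; nlinarith
  · have h2 : (2 : ℝ) ≤ (c.re : ℝ) ^ 2 + (c.im : ℝ) ^ 2 := by
      have : 2 ≤ c.norm := by omega
      rw [norm_cast_real rfl]; exact_mod_cast this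
    -- `2 x p ≤ p² / 5 + 5 x²`, and likewise for the other coordinate.
    nlinarith [sq_nonneg ((c.re : ℝ) - 5 * x), sq_nonneg ((c.im : ℝ) - 5 * y)]

/-! ### Regular words -/

/-- The sequence without its first term. -/
def shift (a : ℕ → GaussianInt) : ℕ → GaussianInt := fun k => a (k + 1)

/-- The state reached from the state `D` after `n` terms of `a`. -/
def state (D : Set GaussianInt) (a : ℕ → GaussianInt) : ℕ → Set GaussianInt
  | 0 => D
  | n + 1 => next (state D a n) (a n)

/-- The first `n` terms of `a` can be read starting from the state `D`. -/
def Admissible (D : Set GaussianInt) (a : ℕ → GaussianInt) (n : ℕ) : Prop :=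
  ∀ k < n, Allowed (state D a k) (a k)

lemma state_succ (D : Set GaussianInt) (a : ℕ → GaussianInt) (n : ℕ) :
    state D a (n + 1) = state (next D (a 0)) (shift a) n := by
  induction n with
  | zero => rfl
  | succ n ih => rw [state, ih]; rfl

lemma admissible_succ {D : Set GaussianInt} {a : ℕ → GaussianInt} {n : ℕ} :
    Admissible D a (n + 1) ↔ Allowed D (a 0) ∧ Admissible (next D (a 0)) (shift a) n := by
  constructor
  · intro h
    refine ⟨h 0 n.succ_pos, fun k hk => ?_⟩
    rw [← state_succ]
    exact h (k + 1) (by omega)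
  · rintro ⟨h0, h⟩ k hk
    cases k with
    | zero => exact h0
    | succ k => rw [state_succ]; exact h k (by omega)

lemma admissible_succ' {D : Set GaussianInt} {a : ℕ → GaussianInt} {n : ℕ} :
    Admissible D a (n + 1) ↔ Admissible D a n ∧ Allowed (state D a n) (a n) :=
  ⟨fun h => ⟨fun k hk => h k (by omega), h n n.lt_succ_self⟩, fun ⟨h1, h2⟩ k hk => by
    rcases Nat.lt_succ_iff_lt_or_eq.1 hk with hk | rfl
    exacts [h1 k hk, h2]⟩

lemma Admissible.mono {D : Set GaussianInt} {a : ℕ → GaussianInt} {m n : ℕ}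
    (h : Admissible D a n) (hmn : m ≤ n) : Admissible D a m :=
  fun k hk => h k (lt_of_lt_of_le hk hmn)

lemma state_congr {D : Set GaussianInt} {a b : ℕ → GaussianInt} {n : ℕ}
    (h : ∀ k < n, a k = b k) : state D a n = state D b n := by
  induction n with
  | zero => rfl
  | succ n ih => rw [state, state, ih fun k hk => h k (by omega), h n n.lt_succ_self]

lemma Admissible.congr {D : Set GaussianInt} {a b : ℕ → GaussianInt} {n : ℕ}
    (ha : Admissible D a n) (h : ∀ k < n, a k = b k) : Admissible D b n := fun k hk => by
  rw [← h k hk, ← state_congr fun l hl => h l (hl.trans hk)]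
  exact ha k hk

lemma pref_zero_eq (a : ℕ → GaussianInt) (n : ℕ) : pref a (n + 1) 0 = a 0 := rfl

lemma tail_pref (a : ℕ → GaussianInt) (n : ℕ) : Fin.tail (pref a (n + 1)) = pref (shift a) n := rfl

lemma isOpen_openRegion_empty : IsOpen (openRegion ∅) := by
  have : openRegion ∅ = {z : ℂ | -(1 / 2) < z.re} ∩ {z | z.re < 1 / 2} ∩
      ({z | -(1 / 2) < z.im} ∩ {z | z.im < 1 / 2}) := by
    ext z; exact mem_openRegion_empty
  rw [this]
  exact ((isOpen_lt continuous_const Complex.continuous_re).inter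
    (isOpen_lt Complex.continuous_re continuous_const)).inter
    ((isOpen_lt continuous_const Complex.continuous_im).inter
    (isOpen_lt Complex.continuous_im continuous_const))

lemma square_eq : square = Set.Ico (-(1 / 2) : ℝ) (1 / 2) ×ℂ Set.Ico (-(1 / 2) : ℝ) (1 / 2) := by
  ext z
  simp [square, Complex.mem_reProdIm, and_assoc]

lemma interior_square : interior square = openRegion ∅ := by
  rw [square_eq, Complex.interior_reProdIm, interior_Ico]
  ext z
  rw [mem_openRegion_empty]
  rfl

lemma closure_square : closure square = closedRegion ∅ := by
  rw [square_eq, Complex.closure_reProdIm, closure_Ico (by norm_num)]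
  ext z
  rw [mem_closedRegion_empty, abs_le, abs_le]
  rfl

lemma openRegion_empty_subset_square : openRegion ∅ ⊆ square :=
  interior_square ▸ interior_subset

lemma isOpen_inverse_branch {O : Set ℂ} (hO : IsOpen O) (d : GaussianInt) :
    IsOpen {z : ℂ | z ≠ 0 ∧ z⁻¹ - d ∈ O} := by
  have hc : ContinuousOn (fun z : ℂ => z⁻¹ - (d : ℂ)) {0}ᶜ :=
    continuousOn_inv₀.sub continuousOn_const
  exact hc.isOpen_inter_preimage isOpen_compl_singleton hO

lemma isOpen_branch {O : Set ℂ} (hO : IsOpen O) (d : GaussianInt) :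
    IsOpen {u : ℂ | u + d ≠ 0 ∧ (u + d)⁻¹ ∈ O} := by
  have h : IsOpen {w : ℂ | w ≠ 0 ∧ w⁻¹ ∈ O} :=
    continuousOn_inv₀.isOpen_inter_preimage isOpen_compl_singleton hO
  exact h.preimage (continuous_id.add continuous_const)

lemma nearest_add {u : ℂ} (hu : u ∈ square) (d : GaussianInt) : nearest (u + d) = d := by
  obtain ⟨h1, h2, h3, h4⟩ := hu
  ext
  · change ⌊(u + (d : ℂ)).re + 1 / 2⌋ = d.re
    rw [Complex.add_re, ← GaussianInt.intCast_re, Int.floor_eq_iff]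
    constructor <;> linarith
  · change ⌊(u + (d : ℂ)).im + 1 / 2⌋ = d.im
    rw [Complex.add_im, ← GaussianInt.intCast_im, Int.floor_eq_iff]
    constructor <;> linarith

lemma sub_nearest_mem_square (w : ℂ) : w - nearest w ∈ square := by
  have h1 := Int.floor_le (w.re + 1 / 2)
  have h2 := Int.lt_floor_add_one (w.re + 1 / 2)
  have h3 := Int.floor_le (w.im + 1 / 2)
  have h4 := Int.lt_floor_add_one (w.im + 1 / 2)
  refine ⟨?_, ?_, ?_, ?_⟩ <;>
    simp only [Complex.sub_re, Complex.sub_im, ← GaussianInt.intCast_re, ← GaussianInt.intCast_im,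
      nearest] <;> linarith

lemma gaussMap_mem_square {z : ℂ} (hz : z ∈ square) : gaussMap z ∈ square := by
  rw [gaussMap]
  split_ifs with h
  · exact h ▸ hz
  · exact sub_nearest_mem_square _

/-- Reading the first letter of a word of a cylinder. -/
lemma mem_cylinder_succ {a : ℕ → GaussianInt} {n : ℕ} {z : ℂ} (hz : z ∈ square) :
    z ∈ cylinder (pref a (n + 1)) ↔
      z ≠ 0 ∧ nearest z⁻¹ = a 0 ∧ gaussMap z ∈ cylinder (pref (shift a) n) := by
  constructor
  · rintro ⟨-, h⟩
    refine ⟨(h 0).1, (h 0).2, gaussMap_mem_square hz, fun k => ?_⟩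
    exact h k.succ
  · rintro ⟨h0, h1, -, h2⟩
    refine ⟨hz, fun k => ?_⟩
    cases k using Fin.cases with
    | zero => exact ⟨h0, h1⟩
    | succ k => exact h2 k

/-- An admissible word has an open set of points that follow it. -/
lemma exists_open_of_admissible {a : ℕ → GaussianInt} {n : ℕ} {D : Set GaussianInt} (hD : Good D)
    (h : Admissible D a n) : ∃ O : Set ℂ, IsOpen O ∧ O ⊆ openRegion ∅ ∧
      O ⊆ cylinder (pref a n) ∧ (O ∩ openRegion D).Nonempty := by
  induction n generalizing a D with
  | zero =>
    obtain ⟨z, hz⟩ := openRegion_nonempty hD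
    exact ⟨openRegion ∅, isOpen_openRegion_empty, subset_rfl,
      fun u hu => ⟨openRegion_empty_subset_square hu, fun k => k.elim0⟩,
      z, region_mono _ (Set.empty_subset _) hz, hz⟩
  | succ n ih =>
    obtain ⟨h0, h1⟩ := admissible_succ.1 h
    obtain ⟨O, hO, hO1, hO2, u, huO, hu⟩ := ih (good_next h0) h1
    have hmem := inv_add_mem_region isPositivity_Ioi h0 hD.1 hu
    have hmem' := region_mono _ (Set.empty_subset _) hmem
    obtain ⟨b1, b2⟩ := region_bounds isPositivity_Ioi hu
    have hne := add_ne_zero_of_bounds b1 b2 h0.1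
    refine ⟨{z | z ≠ 0 ∧ z⁻¹ - a 0 ∈ O} ∩ openRegion ∅,
      (isOpen_inverse_branch hO _).inter isOpen_openRegion_empty, Set.inter_subset_right, ?_,
      (u + a 0)⁻¹, ⟨⟨inv_ne_zero hne, by simpa using huO⟩, hmem'⟩, hmem⟩
    rintro z ⟨⟨hz0, hzO⟩, hz⟩
    have hn : nearest z⁻¹ = a 0 := by
      have := nearest_add (openRegion_empty_subset_square (hO1 hzO)) (a 0)
      rwa [sub_add_cancel] at this
    refine (mem_cylinder_succ (openRegion_empty_subset_square hz)).2 ⟨hz0, hn, ?_⟩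
    rw [gaussMap, if_neg hz0, hn]
    exact hO2 hzO

/-- A word followed by all points of an open subset of the region of a state is admissible. The
images of this open set are open, so they avoid the sides of the square, where ties occur. -/
lemma admissible_of_open {a : ℕ → GaussianInt} {n : ℕ} {D : Set GaussianInt} {O : Set ℂ}
    (hO : IsOpen O) (hne : O.Nonempty) (hD : O ⊆ openRegion D) (hc : O ⊆ cylinder (pref a n)) :
    Admissible D a n := by
  induction n generalizing a D O with
  | zero => exact fun k hk => absurd hk k.not_lt_zero
  | succ n ih =>
    have hcyl : ∀ z ∈ O, z ≠ 0 ∧ z⁻¹ - a 0 ∈ cylinder (pref (shift a) n) := by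
      intro z hz
      obtain ⟨h0, hn, hg⟩ := (mem_cylinder_succ (hc hz).1).1 (hc hz)
      rw [gaussMap, if_neg h0, hn] at hg
      exact ⟨h0, hg⟩
    set O' : Set ℂ := {u : ℂ | u + a 0 ≠ 0 ∧ (u + a 0)⁻¹ ∈ O} with hO'
    have hopen : IsOpen O' := isOpen_branch hO _
    have hcyl' : O' ⊆ cylinder (pref (shift a) n) := by
      rintro u ⟨-, hu⟩
      simpa using (hcyl _ hu).2
    have hsq : O' ⊆ openRegion ∅ := by
      rw [← interior_square]
      exact interior_maximal (fun u hu => (hcyl' hu).1) hopen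
    have hmem : ∀ z ∈ O, z⁻¹ - a 0 ∈ O' := fun z hz => by
      simpa [hO'] using ⟨(hcyl z hz).1, hz⟩
    obtain ⟨z, hz⟩ := hne
    refine admissible_succ.2 ⟨allowed_of_openRegion (hD hz) (hcyl z hz).1 (hsq (hmem z hz)),
      ih hopen ⟨_, hmem z hz⟩ (fun u hu => ?_) hcyl'⟩
    have := inv_sub_mem_region isPositivity_Ioi (hD hu.2) (inv_ne_zero hu.1)
      (d := a 0) (by simpa using hsq hu)
    simpa using this

/-- Regularity of a word is decided by the finite automaton of states. -/
theorem regularWord_iff {a : ℕ → GaussianInt} {n : ℕ} :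
    RegularWord (pref a n) ↔ Admissible ∅ a n := by
  constructor
  · intro h
    refine admissible_of_open isOpen_interior h ?_ interior_subset
    rw [← interior_square]
    exact interior_mono fun z hz => hz.1
  · intro h
    obtain ⟨O, hO, -, hc, z, hz, -⟩ := exists_open_of_admissible good_empty h
    exact ⟨z, interior_maximal hc hO hz⟩

lemma mem_Rbar_iff {a : ℕ → GaussianInt} : a ∈ Rbar ↔ ∀ n, Admissible ∅ a n := by
  constructor
  · intro h n
    rcases Nat.eq_zero_or_pos n with rfl | hn
    · exact fun k hk => absurd hk k.not_lt_zero
    · exact regularWord_iff.1 (h n hn)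
  · exact fun h n _ => regularWord_iff.2 (h n)

/-! ### Convergence -/

lemma convergent_zero (a : ℕ → GaussianInt) : convergent a 0 = 0 := rfl

lemma convergent_succ (a : ℕ → GaussianInt) (n : ℕ) :
    convergent a (n + 1) = (convergent (shift a) n + a 0)⁻¹ := by
  simp only [convergent, cfValue, tail_pref, pref_zero_eq, one_div]
  rw [add_comm]

lemma convergent_congr {a b : ℕ → GaussianInt} {n : ℕ} (h : ∀ k < n, a k = b k) :
    convergent a n = convergent b n := by
  have : pref a n = pref b n := funext fun k => h k k.2
  rw [convergent, convergent, this]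

/-- The convergents of admissible words lie in the closed region. -/
lemma convergent_mem {a : ℕ → GaussianInt} {n : ℕ} {D : Set GaussianInt} (hD : 0 ∉ D)
    (h : Admissible D a n) : convergent a n ∈ closedRegion D := by
  induction n generalizing a D with
  | zero => exact zero_mem_closedRegion hD
  | succ n ih =>
    obtain ⟨h0, h1⟩ := admissible_succ.1 h
    rw [convergent_succ]
    exact inv_add_mem_region isPositivity_Ici h0 hD (ih h0.2.1 h1)

lemma cfDefined_pref {a : ℕ → GaussianInt} {n : ℕ} {D : Set GaussianInt}
    (h : Admissible D a n) : CFDefined n (pref a n) := by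
  induction n generalizing a D with
  | zero => trivial
  | succ n ih =>
    obtain ⟨h0, h1⟩ := admissible_succ.1 h
    obtain ⟨b1, b2⟩ := region_bounds isPositivity_Ici (convergent_mem h0.2.1 h1)
    refine ⟨?_, ih h1⟩
    have := add_ne_zero_of_bounds b1 b2 h0.1
    rwa [add_comm] at this

lemma norm_sub_le_of_inv {x y u v d : ℂ} (hx : ‖x‖ ^ 2 ≤ 1 / 2) (hy : ‖y‖ ^ 2 ≤ 1 / 2)
    (hx0 : x ≠ 0) (hy0 : y ≠ 0) (hu : x⁻¹ = u + d) (hv : y⁻¹ = v + d) :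
    ‖x - y‖ ≤ 1 / 2 * ‖u - v‖ := by
  have h : x - y = -(x * y * (u - v)) := by
    have : u - v = x⁻¹ - y⁻¹ := by rw [hu, hv]; ring
    rw [this]
    field_simp
    ring
  rw [h, norm_neg, norm_mul, norm_mul]
  refine mul_le_mul_of_nonneg_right ?_ (norm_nonneg _)
  nlinarith [sq_nonneg (‖x‖ - ‖y‖)]

/-- `ζ` records the remainders of an expansion `a` of the point `ζ 0`, with all remainders nonzero
and in the closed square; the digits need not be nearest integers in case of a tie. -/
def IsOrbit (a : ℕ → GaussianInt) (ζ : ℕ → ℂ) : Prop :=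
  ∀ k, ζ k ≠ 0 ∧ ζ k ∈ closedRegion ∅ ∧ ζ (k + 1) = (ζ k)⁻¹ - a k

lemma IsOrbit.shift {a : ℕ → GaussianInt} {ζ : ℕ → ℂ} (h : IsOrbit a ζ) :
    IsOrbit (shift a) fun k => ζ (k + 1) := fun k => h (k + 1)

lemma IsOrbit.mem_closedRegion {a : ℕ → GaussianInt} {ζ : ℕ → ℂ} (h : IsOrbit a ζ) (n : ℕ) :
    ζ n ∈ closedRegion (state ∅ a n) := by
  induction n with
  | zero => exact (h 0).2.1
  | succ n ih =>
    have := (h (n + 1)).2.1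
    rw [(h n).2.2] at this ⊢
    exact inv_sub_mem_region isPositivity_Ici ih (h n).1 this

lemma IsOrbit.inv_eq {a : ℕ → GaussianInt} {ζ : ℕ → ℂ} (h : IsOrbit a ζ) (n : ℕ) :
    (ζ n)⁻¹ = ζ (n + 1) + a n := by rw [(h n).2.2]; ring

lemma norm_le_one_of_mem {D : Set GaussianInt} {z : ℂ} (hz : z ∈ closedRegion D) : ‖z‖ ≤ 1 := by
  have := norm_sq_le_half isPositivity_Ici hz
  nlinarith [norm_nonneg z]

lemma convergent_ne_zero {a : ℕ → GaussianInt} {n : ℕ} {D : Set GaussianInt}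
    (h : Admissible D a (n + 1)) : convergent a (n + 1) ≠ 0 := by
  obtain ⟨h0, h1⟩ := admissible_succ.1 h
  obtain ⟨b1, b2⟩ := region_bounds isPositivity_Ici (convergent_mem h0.2.1 h1)
  rw [convergent_succ]
  exact inv_ne_zero (add_ne_zero_of_bounds b1 b2 h0.1)

/-- The inverse branches contract by the factor `1 / 2`, because `|z|² ≤ 1 / 2` on the square. -/
lemma IsOrbit.norm_sub_convergent_le {a : ℕ → GaussianInt} {ζ : ℕ → ℂ} {n : ℕ}
    {D : Set GaussianInt} (hD : 0 ∉ D) (hζ : IsOrbit a ζ) (h : Admissible D a n) :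
    ‖ζ 0 - convergent a n‖ ≤ (1 / 2) ^ n := by
  induction n generalizing a ζ D with
  | zero => simpa [convergent_zero] using norm_le_one_of_mem (hζ 0).2.1
  | succ n ih =>
    obtain ⟨h0, h1⟩ := admissible_succ.1 h
    refine (norm_sub_le_of_inv (norm_sq_le_half isPositivity_Ici (hζ 0).2.1)
      (norm_sq_le_half isPositivity_Ici (convergent_mem hD h)) (hζ 0).1 (convergent_ne_zero h)
      (hζ.inv_eq 0) (v := convergent (HurwitzCF.shift a) n) (by rw [convergent_succ, inv_inv])).trans
      ?_
    have := ih h0.2.1 hζ.shift h1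
    rw [pow_succ']
    simpa using this

lemma norm_convergent_sub_le {a : ℕ → GaussianInt} {n : ℕ} {D : Set GaussianInt} (hD : 0 ∉ D)
    (h : Admissible D a (n + 1)) : ‖convergent a n - convergent a (n + 1)‖ ≤ (1 / 2) ^ n := by
  induction n generalizing a D with
  | zero => simpa [convergent_zero] using norm_le_one_of_mem (convergent_mem hD h)
  | succ n ih =>
    obtain ⟨h0, h1⟩ := admissible_succ.1 h
    have h' := h.mono (Nat.le_succ (n + 1))
    refine (norm_sub_le_of_inv (norm_sq_le_half isPositivity_Ici (convergent_mem hD h'))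
      (norm_sq_le_half isPositivity_Ici (convergent_mem hD h)) (convergent_ne_zero h')
      (convergent_ne_zero h) (u := convergent (shift a) n) (v := convergent (shift a) (n + 1))
      (d := a 0) (by rw [convergent_succ, inv_inv]) (by rw [convergent_succ, inv_inv])).trans ?_
    have := ih h0.2.1 h1
    rw [pow_succ' _ n]
    simpa using this

lemma exists_tendsto_convergent {a : ℕ → GaussianInt} {D : Set GaussianInt} (hD : 0 ∉ D)
    (h : ∀ n, Admissible D a n) : ∃ z, Tendsto (convergent a) atTop (𝓝 z) := by
  refine cauchySeq_tendsto_of_complete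
    (cauchySeq_of_le_geometric (1 / 2) 1 (by norm_num) fun n => ?_)
  rw [dist_eq_norm, one_mul]
  exact norm_convergent_sub_le hD (h (n + 1))

lemma LambdaBar_eq {a : ℕ → GaussianInt} {z : ℂ} (h : Tendsto (convergent a) atTop (𝓝 z)) :
    LambdaBar a = z := h.limUnder_eq

lemma tendsto_convergent_of_norm_le {a : ℕ → GaussianInt} {z : ℂ}
    (h : ∀ n, ‖z - convergent a n‖ ≤ (1 / 2) ^ n) : Tendsto (convergent a) atTop (𝓝 z) := by
  rw [tendsto_iff_dist_tendsto_zero]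
  refine squeeze_zero (fun _ => dist_nonneg) (fun n => ?_)
    (tendsto_pow_atTop_nhds_zero_of_lt_one (r := (1 / 2 : ℝ)) (by norm_num) (by norm_num))
  rw [dist_comm, dist_eq_norm]
  exact h n

lemma isClosed_closedRegion_empty : IsClosed (closedRegion ∅) := by
  rw [← closure_square]; exact isClosed_closure

/-- The values of the tails of an infinite admissible sequence form an orbit. -/
lemma isOrbit_tails {a : ℕ → GaussianInt} {D : Set GaussianInt} (hD : 0 ∉ D)
    (h : ∀ n, Admissible D a n) : ∃ ζ, IsOrbit a ζ ∧ ζ 0 = LambdaBar a := by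
  set A : ℕ → ℕ → GaussianInt := fun k l => a (l + k) with hA
  have hsh : ∀ k, shift (A k) = A (k + 1) := fun k => funext fun l => by
    simp only [shift, hA]; congr 1; omega
  have key : ∀ k, ∃ E : Set GaussianInt, 0 ∉ E ∧ ∀ n, Admissible E (A k) n := by
    intro k
    induction k with
    | zero => exact ⟨D, hD, h⟩
    | succ k ih =>
      obtain ⟨E, hE, hk⟩ := ih
      refine ⟨next E (A k 0), (admissible_succ.1 (hk 1)).1.2.1, fun n => ?_⟩
      rw [← hsh]
      exact (admissible_succ.1 (hk (n + 1))).2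
  have hlim : ∀ k, Tendsto (convergent (A k)) atTop (𝓝 (LambdaBar (A k))) := fun k => by
    obtain ⟨E, hE, hk⟩ := key k
    exact tendsto_nhds_limUnder (exists_tendsto_convergent hE hk)
  have hmem : ∀ k, LambdaBar (A k) ∈ closedRegion ∅ := fun k => by
    obtain ⟨E, hE, hk⟩ := key k
    exact isClosed_closedRegion_empty.mem_of_tendsto (hlim k) (Eventually.of_forall fun n =>
      region_mono _ (Set.empty_subset _) (convergent_mem hE (hk n)))
  refine ⟨fun k => LambdaBar (A k), fun k => ?_, rfl⟩
  obtain ⟨E, hE, hk⟩ := key k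
  obtain ⟨b1, b2⟩ := region_bounds isPositivity_Ici (hmem (k + 1))
  have hne := add_ne_zero_of_bounds b1 b2 (admissible_succ.1 (hk 1)).1.1
  have h1 : Tendsto (fun n => convergent (A k) (n + 1)) atTop
      (𝓝 (LambdaBar (A (k + 1)) + A k 0)⁻¹) := by
    simp only [convergent_succ, hsh]
    exact ((hlim (k + 1)).add_const _).inv₀ hne
  have h2 := tendsto_nhds_unique ((tendsto_add_atTop_iff_nat 1).2 (hlim k)) h1
  have h3 : A k 0 = a k := by simp [hA]
  rw [h3] at h2 hne
  dsimp only
  refine ⟨?_, hmem k, ?_⟩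
  · rw [h2]; exact inv_ne_zero hne
  · rw [h2, inv_inv]; ring

/-! ### Irrationality of the values -/

lemma exists_div_of_gaussianRational {z : ℂ} (hz : z ∈ gaussianRationals) :
    ∃ p q : GaussianInt, q ≠ 0 ∧ z * q = p := by
  obtain ⟨x, y, rfl⟩ := hz
  refine ⟨⟨x.num * y.den, y.num * x.den⟩, ⟨x.den * y.den, 0⟩, ?_, ?_⟩
  · intro h
    have := congrArg Zsqrtd.re h
    simp at this
  · have hx : (x : ℂ) * x.den = x.num := by exact_mod_cast Rat.mul_den_eq_num x
    have hy : (y : ℂ) * y.den = y.num := by exact_mod_cast Rat.mul_den_eq_num y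
    rw [GaussianInt.toComplex_def', GaussianInt.toComplex_def']
    push_cast
    linear_combination (y.den : ℂ) * hx + (x.den : ℂ) * Complex.I * hy

/-- Along an orbit a Gaussian rational would produce nonzero Gaussian integers of strictly
decreasing norms, as in the Euclidean algorithm. -/
lemma IsOrbit.not_mem_gaussianRationals {a : ℕ → GaussianInt} {ζ : ℕ → ℂ} (h : IsOrbit a ζ) :
    ζ 0 ∉ gaussianRationals := by
  intro hz
  obtain ⟨p, q, hq, hpq⟩ := exists_div_of_gaussianRational hz
  have key : ∀ n : ℕ, ∀ (k : ℕ) (p q : GaussianInt), q.norm ≤ n → q ≠ 0 → ζ k * q ≠ p := by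
    intro n
    induction n with
    | zero =>
      intro k p q hn hq
      have := GaussianInt.norm_pos.2 hq
      push_cast at hn
      omega
    | succ n ih =>
      intro k p q hn hq hpq
      have hp : p ≠ 0 := by
        rintro rfl
        simp [(h k).1, hq] at hpq
      refine ih (k + 1) (q - a k * p) p ?_ hp ?_
      · have h1 : Complex.normSq (ζ k) * Complex.normSq q = Complex.normSq p := by
          rw [← map_mul, hpq]
        have h2 := normSq_le_half isPositivity_Ici (h k).2.1
        rw [← GaussianInt.intCast_real_norm, ← GaussianInt.intCast_real_norm] at h1
        have h3 : (0 : ℝ) < q.norm := by exact_mod_cast GaussianInt.norm_pos.2 hq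
        have h4 : (p.norm : ℝ) < q.norm := by nlinarith
        have h5 : p.norm < q.norm := by exact_mod_cast h4
        push_cast at hn
        omega
      · rw [(h k).2.2, ← hpq]
        have := (h k).1
        simp only [GaussianInt.toComplex_sub, GaussianInt.toComplex_mul, ← hpq]
        field_simp
  exact key q.norm.toNat 0 p q (Int.self_le_toNat _) hq hpq

lemma not_rational_ne_zero {z : ℂ} (hz : z ∉ gaussianRationals) : z ≠ 0 := by
  rintro rfl
  exact hz ⟨0, 0, by simp⟩

lemma inv_sub_not_rational {z : ℂ} (hz : z ∉ gaussianRationals) (d : GaussianInt) :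
    z⁻¹ - d ∉ gaussianRationals := by
  rintro ⟨x, y, h⟩
  apply hz
  have h1 : z⁻¹ = ((x + d.re : ℚ) : ℂ) + ((y + d.im : ℚ) : ℂ) * Complex.I := by
    rw [eq_add_of_sub_eq h, GaussianInt.toComplex_def]; push_cast; ring
  set X : ℚ := x + d.re
  set Y : ℚ := y + d.im
  have hXY : X ^ 2 + Y ^ 2 ≠ 0 := by
    intro h0
    have hX : X = 0 := by nlinarith
    have hY : Y = 0 := by nlinarith
    exact inv_ne_zero (not_rational_ne_zero hz) (by rw [h1, hX, hY]; simp)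
  have hXY' : (X : ℂ) ^ 2 + (Y : ℂ) ^ 2 ≠ 0 := by exact_mod_cast hXY
  refine ⟨X / (X ^ 2 + Y ^ 2), -Y / (X ^ 2 + Y ^ 2), ?_⟩
  rw [← inv_inv z, h1]
  refine inv_eq_of_mul_eq_one_right ?_
  push_cast
  field_simp
  linear_combination -(Y : ℂ) ^ 2 * Complex.I_sq

/-! ### Expansions of the points of the closed square -/

lemma floor_add_half_bounds (x : ℝ) : |x - ⌊x + 1 / 2⌋| ≤ 1 / 2 := by
  have h1 := Int.floor_le (x + 1 / 2)
  have h2 := Int.lt_floor_add_one (x + 1 / 2)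
  rw [abs_le]
  constructor <;> linarith

lemma ceil_sub_half_bounds (x : ℝ) : |x - ⌈x - 1 / 2⌉| ≤ 1 / 2 := by
  have h1 := Int.le_ceil (x - 1 / 2)
  have h2 := Int.ceil_lt_add_one (x - 1 / 2)
  rw [abs_le]
  constructor <;> linarith

/-- Rounding of one coordinate, with the ties broken as the state demands. -/
lemma exists_round {p q : Prop} (hpq : ¬ (p ∧ q)) (x : ℝ) (hp : p → x ≤ 1 / 2)
    (hq : q → -(1 / 2) ≤ x) : ∃ n : ℤ, |x - n| ≤ 1 / 2 ∧ (p → n ≤ 0) ∧ (q → 0 ≤ n) := by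
  by_cases h : p
  · refine ⟨⌈x - 1 / 2⌉, ceil_sub_half_bounds x, fun _ => ?_, fun hq' => absurd ⟨h, hq'⟩ hpq⟩
    rw [Int.ceil_le]
    have := hp h
    push_cast
    linarith
  · refine ⟨⌊x + 1 / 2⌋, floor_add_half_bounds x, fun hp' => absurd hp' h, fun hq' => ?_⟩
    rw [Int.le_floor]
    have := hq hq'
    push_cast
    linarith

lemma re_unit_mul_inv_le {D : Set GaussianInt} {z : ℂ} (hz : z ∈ closedRegion D) (h0 : z ≠ 0)
    {c : GaussianInt} (hc : c ∈ D) (hn : c.norm = 1) :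
    (c.re : ℝ) * z⁻¹.re - c.im * z⁻¹.im ≤ 1 / 2 := by
  have hw : z⁻¹ ≠ 0 := inv_ne_zero h0
  have hN : 0 < Complex.normSq z⁻¹ := by simpa using h0
  have h3 := hz.2 c hc
  have e3 := normSq_inv_sub_unit hw hn
  rw [inv_inv] at e3
  rw [← isPositivity_Ici.mul_iff _ _ hN, e3, Set.mem_Ici, re_coe_mul] at h3
  linarith

lemma exists_allowed {D : Set GaussianInt} (hD : Good D) {z : ℂ} (hz : z ∈ closedRegion D)
    (h0 : z ≠ 0) : ∃ d, Allowed D d ∧ z⁻¹ - d ∈ closedRegion ∅ := by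
  have hr := fun c hc hn => re_unit_mul_inv_le hz h0 (c := c) hc hn
  obtain ⟨m, hm, hm1, hm2⟩ := exists_round hD.2.1 z⁻¹.re
    (fun h => by have := hr _ h (by simp [norm_eq]); push_cast at this; linarith)
    (fun h => by have := hr _ h (by simp [norm_eq]); push_cast at this; linarith)
  obtain ⟨n, hn, hn1, hn2⟩ := exists_round (fun h => hD.2.2 h.symm) z⁻¹.im
    (fun h => by have := hr _ h (by simp [norm_eq]); push_cast at this; linarith)
    (fun h => by have := hr _ h (by simp [norm_eq]); push_cast at this; linarith)
  have hu : z⁻¹ - ((⟨m, n⟩ : GaussianInt) : ℂ) ∈ closedRegion ∅ := by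
    rw [mem_closedRegion_empty, Complex.sub_re, Complex.sub_im, GaussianInt.re_toComplex,
      GaussianInt.im_toComplex]
    exact ⟨hm, hn⟩
  obtain ⟨a1, a2⟩ := digit_conditions hz h0 hu
  refine ⟨⟨m, n⟩, ⟨a1, a2, fun c hc hc1 => ?_⟩, hu⟩
  rcases unit_cases hc1 with rfl | rfl | rfl | rfl
  · simpa [Zsqrtd.re_mul] using hm1 hc
  · simpa [Zsqrtd.re_mul] using hm2 hc
  · simpa [Zsqrtd.re_mul] using hn2 hc
  · simpa [Zsqrtd.re_mul] using hn1 hc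

lemma isOrbit_of_not_rational {a : ℕ → GaussianInt} {ζ : ℕ → ℂ} (h0 : ζ 0 ∉ gaussianRationals)
    (hmem : ∀ k, ζ k ∈ closedRegion ∅) (hs : ∀ k, ζ (k + 1) = (ζ k)⁻¹ - a k) : IsOrbit a ζ := by
  have : ∀ k, ζ k ∉ gaussianRationals := by
    intro k
    induction k with
    | zero => exact h0
    | succ k ih => rw [hs]; exact inv_sub_not_rational ih _
  exact fun k => ⟨not_rational_ne_zero (this k), hmem k, hs k⟩

/-- Every irrational point of the closed square has an orbit along an admissible sequence. -/
lemma exists_admissible_orbit {z : ℂ} (hz : z ∈ closedRegion ∅) (hi : z ∉ gaussianRationals) :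
    ∃ a ζ, IsOrbit a ζ ∧ ζ 0 = z ∧ ∀ n, Admissible ∅ a n := by
  let X := {x : Set GaussianInt × ℂ // Good x.1 ∧ x.2 ∈ closedRegion x.1 ∧ x.2 ∉ gaussianRationals}
  have hex : ∀ x : X, ∃ d, Allowed x.1.1 d ∧ x.1.2⁻¹ - d ∈ closedRegion ∅ := fun x =>
    exists_allowed x.2.1 x.2.2.1 (not_rational_ne_zero x.2.2.2)
  choose dig h1 h2 using hex
  let f : X → X := fun x => ⟨(next x.1.1 (dig x), x.1.2⁻¹ - dig x), good_next (h1 x),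
    inv_sub_mem_region isPositivity_Ici x.2.2.1 (not_rational_ne_zero x.2.2.2) (h2 x),
    inv_sub_not_rational x.2.2.2 _⟩
  let x : ℕ → X := fun n => f^[n] ⟨(∅, z), good_empty, hz, hi⟩
  have hx : ∀ n, x (n + 1) = f (x n) := fun n => Function.iterate_succ_apply' f n _
  refine ⟨fun n => dig (x n), fun n => (x n).1.2, ?_, rfl, fun n k _ => ?_⟩
  · refine isOrbit_of_not_rational hi
      (fun k => region_mono _ (Set.empty_subset _) (x k).2.2.1) fun k => ?_
    rw [hx]
  · have : ∀ k, state ∅ (fun n => dig (x n)) k = (x k).1.1 := by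
      intro k
      induction k with
      | zero => rfl
      | succ k ih => rw [state, ih, hx]
    rw [this]
    exact h1 (x k)

lemma IsOrbit.tendsto {a : ℕ → GaussianInt} {ζ : ℕ → ℂ} (h : IsOrbit a ζ)
    (ha : ∀ n, Admissible ∅ a n) : Tendsto (convergent a) atTop (𝓝 (ζ 0)) :=
  tendsto_convergent_of_norm_le fun n => h.norm_sub_convergent_le (Set.notMem_empty _) (ha n)

theorem LambdaBar_image : LambdaBar '' Rbar = closure square \ gaussianRationals := by
  rw [closure_square]
  ext z
  constructor
  · rintro ⟨a, ha, rfl⟩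
    obtain ⟨ζ, hζ, h0⟩ := isOrbit_tails (Set.notMem_empty _) (mem_Rbar_iff.1 ha)
    rw [← h0]
    exact ⟨(hζ 0).2.1, hζ.not_mem_gaussianRationals⟩
  · rintro ⟨hz, hi⟩
    obtain ⟨a, ζ, hζ, rfl, ha⟩ := exists_admissible_orbit hz hi
    exact ⟨a, mem_Rbar_iff.2 ha, LambdaBar_eq (hζ.tendsto ha)⟩

/-! ### The algorithm -/

lemma isOrbit_gauss {z : ℂ} (hz : z ∈ square) (hi : z ∉ gaussianRationals) :
    IsOrbit (partialQuotient z) fun k => gaussMap^[k] z := by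
  have hsq : ∀ k, gaussMap^[k] z ∈ square := by
    intro k
    induction k with
    | zero => exact hz
    | succ k ih => rw [Function.iterate_succ_apply']; exact gaussMap_mem_square ih
  have hirr : ∀ k, gaussMap^[k] z ∉ gaussianRationals := by
    intro k
    induction k with
    | zero => exact hi
    | succ k ih =>
      rw [Function.iterate_succ_apply', gaussMap, if_neg (not_rational_ne_zero ih)]
      exact inv_sub_not_rational ih _
  refine fun k => ⟨not_rational_ne_zero (hirr k), ?_, ?_⟩
  · rw [← closure_square]; exact subset_closure (hsq k)
  · dsimp only
    rw [Function.iterate_succ_apply', gaussMap, if_neg (not_rational_ne_zero (hirr k))]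
    rfl

/-- A digit that is not allowed comes from a tie: for a unit centre `c` of the state the inverse
lies on the line `Re (c w) = 1 / 2` and has been rounded to the wrong side. -/
lemma tie_of_not_allowed {D : Set GaussianInt} {z : ℂ} {d : GaussianInt} (hz : z ∈ closedRegion D)
    (h0 : z ≠ 0) (hu : z⁻¹ - d ∈ closedRegion ∅) {c : GaussianInt} (hc : c ∈ D) (hn : c.norm = 1)
    (hpos : 0 < (c * d).re) :
    (|d.re| = 1 ∧ (z⁻¹ - d).re = -d.re / 2 ∧ c.im = 0) ∨
      (|d.im| = 1 ∧ (z⁻¹ - d).im = -d.im / 2 ∧ c.re = 0) := by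
  have h1 := re_unit_mul_inv_le hz h0 hc hn
  obtain ⟨h2, h3⟩ := mem_closedRegion_empty.1 hu
  rw [abs_le, Complex.sub_re, ← GaussianInt.intCast_re] at h2
  rw [abs_le, Complex.sub_im, ← GaussianInt.intCast_im] at h3
  rw [Complex.sub_re, Complex.sub_im, ← GaussianInt.intCast_re, ← GaussianInt.intCast_im]
  rcases unit_cases hn with rfl | rfl | rfl | rfl
  · left
    have hd : 0 < d.re := by simpa [Zsqrtd.re_mul] using hpos
    have hd' : (d.re : ℝ) ≤ 1 := by push_cast at h1; linarith
    have hd1 : d.re = 1 := by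
      have : d.re ≤ 1 := by exact_mod_cast hd'
      omega
    rw [hd1] at h2 ⊢
    push_cast at h1 h2 ⊢
    exact ⟨by norm_num, by linarith, trivial⟩
  · left
    have hd : d.re < 0 := by simpa [Zsqrtd.re_mul] using hpos
    have hd' : -1 ≤ (d.re : ℝ) := by push_cast at h1; linarith
    have hd1 : d.re = -1 := by
      have : -1 ≤ d.re := by exact_mod_cast hd'
      omega
    rw [hd1] at h2 ⊢
    push_cast at h1 h2 ⊢
    exact ⟨by norm_num, by linarith, trivial⟩
  · right
    have hd : d.im < 0 := by simpa [Zsqrtd.re_mul] using hpos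
    have hd' : -1 ≤ (d.im : ℝ) := by push_cast at h1; linarith
    have hd1 : d.im = -1 := by
      have : -1 ≤ d.im := by exact_mod_cast hd'
      omega
    rw [hd1] at h3 ⊢
    push_cast at h1 h3 ⊢
    exact ⟨by norm_num, by linarith, trivial⟩
  · right
    have hd : 0 < d.im := by simpa [Zsqrtd.re_mul] using hpos
    have hd' : (d.im : ℝ) ≤ 1 := by push_cast at h1; linarith
    have hd1 : d.im = 1 := by
      have : d.im ≤ 1 := by exact_mod_cast hd'
      omega
    rw [hd1] at h3 ⊢
    push_cast at h1 h3 ⊢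
    exact ⟨by norm_num, by linarith, trivial⟩

/-- The inverse of a point of the closed square is at distance at least `1` from every unit. -/
lemma one_le_normSq_inv_sub_unit {z : ℂ} (hz : z ∈ closedRegion ∅) (h0 : z ≠ 0) {c : GaussianInt}
    (hn : c.norm = 1) : 1 ≤ Complex.normSq (z⁻¹ - c) := by
  have hN : 0 < Complex.normSq z⁻¹ := by simpa using h0
  have h := hz.1 c hn
  have e := re_unit_mul_inv (inv_ne_zero h0) hn
  rw [inv_inv] at e
  rw [← isPositivity_Ici.mul_iff _ _ hN, e, Set.mem_Ici] at h
  linarith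

lemma two_le_abs_im_of_tie {z : ℂ} {d : GaussianInt} (hz : z ∈ closedRegion ∅)
    (h0 : z ≠ 0) (hu : z⁻¹ - d ∈ closedRegion ∅) (h1 : |d.re| = 1)
    (h2 : (z⁻¹ - d).re = -d.re / 2) : 2 ≤ |d.im| := by
  -- If `d.im = 0` then `d` is a unit; otherwise the unit `d.im * i` is too close to `z⁻¹`.
  have hdr : d.re * d.re = 1 := by rw [← abs_mul_abs_self, h1]; rfl
  have hdr' : (d.re : ℝ) * d.re = 1 := by exact_mod_cast hdr
  by_contra! hlt
  have hcases : |d.im| = 0 ∨ |d.im| = 1 := by have := abs_nonneg d.im; omega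
  have hn := normSq_le_half isPositivity_Ici hu
  rcases hcases with h | h
  · have hd : d.norm = 1 := by rw [norm_eq, hdr, abs_eq_zero.1 h]; rfl
    have := one_le_normSq_inv_sub_unit hz h0 hd
    linarith
  · have hdi : d.im * d.im = 1 := by rw [← abs_mul_abs_self, h]; rfl
    have hd : (⟨0, d.im⟩ : GaussianInt).norm = 1 := by rw [norm_eq]; simpa using hdi
    have := one_le_normSq_inv_sub_unit hz h0 hd
    rw [normSq_coe_sub] at this
    have hb := (mem_closedRegion_empty.1 hu).2
    rw [Complex.sub_im, ← GaussianInt.intCast_im, abs_le] at hb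
    rw [Complex.sub_re, ← GaussianInt.intCast_re] at h2
    have h3 : z⁻¹.re = d.re / 2 := by linarith
    dsimp only at this
    rw [h3] at this
    push_cast at this
    nlinarith

lemma two_le_abs_re_of_tie {z : ℂ} {d : GaussianInt} (hz : z ∈ closedRegion ∅)
    (h0 : z ≠ 0) (hu : z⁻¹ - d ∈ closedRegion ∅) (h1 : |d.im| = 1)
    (h2 : (z⁻¹ - d).im = -d.im / 2) : 2 ≤ |d.re| := by
  have hdi : d.im * d.im = 1 := by rw [← abs_mul_abs_self, h1]; rfl
  have hdi' : (d.im : ℝ) * d.im = 1 := by exact_mod_cast hdi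
  by_contra! hlt
  have hcases : |d.re| = 0 ∨ |d.re| = 1 := by have := abs_nonneg d.re; omega
  have hn := normSq_le_half isPositivity_Ici hu
  rcases hcases with h | h
  · have hd : d.norm = 1 := by rw [norm_eq, hdi, abs_eq_zero.1 h]; rfl
    have := one_le_normSq_inv_sub_unit hz h0 hd
    linarith
  · have hdr : d.re * d.re = 1 := by rw [← abs_mul_abs_self, h]; rfl
    have hd : (⟨d.re, 0⟩ : GaussianInt).norm = 1 := by rw [norm_eq]; simpa using hdr
    have := one_le_normSq_inv_sub_unit hz h0 hd
    rw [normSq_coe_sub] at this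
    have hb := (mem_closedRegion_empty.1 hu).1
    rw [Complex.sub_re, ← GaussianInt.intCast_re, abs_le] at hb
    rw [Complex.sub_im, ← GaussianInt.intCast_im] at h2
    have h3 : z⁻¹.im = d.im / 2 := by linarith
    dsimp only at this
    rw [h3] at this
    push_cast at this
    nlinarith

/-- Correcting one digit and reflecting all later ones replaces the later remainders by their
reflections. -/
lemma IsOrbit.reflect {a : ℕ → GaussianInt} {ζ : ℕ → ℂ} (h : IsOrbit a ζ) {j : ℕ}
    {d : GaussianInt} {μ : GaussianInt → GaussianInt} {ρ : ℂ → ℂ} (h0 : ∀ z, z ≠ 0 → ρ z ≠ 0)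
    (hmem : ∀ z ∈ closedRegion ∅, ρ z ∈ closedRegion ∅)
    (hstep : ∀ z c, ρ (z⁻¹ - (c : GaussianInt)) = (ρ z)⁻¹ - (μ c : GaussianInt))
    (hj : ρ (ζ (j + 1)) = (ζ j)⁻¹ - d) :
    IsOrbit (fun l => if l < j then a l else if l = j then d else μ (a l))
      fun k => if k ≤ j then ζ k else ρ (ζ k) := by
  intro k
  obtain ⟨k0, k1, k2⟩ := h k
  dsimp only
  refine ⟨?_, ?_, ?_⟩
  · split_ifs
    exacts [k0, h0 _ k0]
  · split_ifs
    exacts [k1, hmem _ k1]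
  · rcases lt_trichotomy k j with hk | rfl | hk
    · rw [if_pos (by omega), if_pos hk.le, if_pos hk, k2]
    · simp [hj]
    · rw [if_neg (by omega), if_neg (by omega), if_neg (by omega), if_neg (by omega), k2, hstep]

/-- What one correction achieves: the inadmissible digit has one of the two expected forms, and
after the correction the orbit still starts at the same point and is admissible one step further. -/
lemma correctAt_spec {a : ℕ → GaussianInt} {ζ : ℕ → ℂ} (h : IsOrbit a ζ) {j : ℕ}
    (ha : Admissible ∅ a j) (hn : ¬ Allowed (state ∅ a j) (a j)) :
    (IsHorizontal (a j) ∨ IsVertical (a j)) ∧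
      (∃ ξ, IsOrbit (correctAt a j) ξ ∧ ξ 0 = ζ 0) ∧ Admissible ∅ (correctAt a j) (j + 1) := by
  have hz := h.mem_closedRegion j
  obtain ⟨h0, hK, hs⟩ := h j
  have hu : (ζ j)⁻¹ - a j ∈ closedRegion ∅ := hs ▸ (h (j + 1)).2.1
  obtain ⟨d1, d2⟩ := digit_conditions hz h0 hu
  have hprefix : ∀ k < j, correctAt a j k = a k := fun k hk => if_pos hk
  have hcj : correctAt a j j = S (a j) := by simp [correctAt]
  have hstate : state ∅ (correctAt a j) j = state ∅ a j := state_congr hprefix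
  have hadm : ∀ ξ, IsOrbit (correctAt a j) ξ → ξ j = ζ j →
      (∀ c ∈ state ∅ a j, c.norm = 1 → (c * S (a j)).re ≤ 0) →
      Admissible ∅ (correctAt a j) (j + 1) := by
    intro ξ hξ hξj hc
    refine admissible_succ'.2 ⟨ha.congr fun k hk => (hprefix k hk).symm, ?_⟩
    rw [hstate, hcj]
    have hu' : (ζ j)⁻¹ - (S (a j) : GaussianInt) ∈ closedRegion ∅ := by
      have := (hξ (j + 1)).2.1
      rwa [(hξ j).2.2, hcj, hξj] at this
    obtain ⟨e1, e2⟩ := digit_conditions hz h0 hu'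
    exact ⟨e1, e2, hc⟩
  obtain ⟨c, hcD, hcn, hcpos⟩ : ∃ c ∈ state ∅ a j, c.norm = 1 ∧ 0 < (c * a j).re := by
    by_contra! hcon
    exact hn ⟨d1, d2, hcon⟩
  have htie := fun c hc hn hp => tie_of_not_allowed hz h0 hu (c := c) hc hn hp
  rcases htie c hcD hcn hcpos with ⟨t1, t2, -⟩ | ⟨t1, t2, -⟩
  · have him := two_le_abs_im_of_tie hK h0 hu t1 t2
    have hV : IsVertical (a j) := ⟨t1, him⟩
    have hH : ¬ IsHorizontal (a j) := fun hH => by have := hH.1; omega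
    have hS : S (a j) = ⟨0, (a j).im⟩ := by rw [S, if_neg hH, if_pos hV]
    have hM : mirrorFor (a j) = mirror₂ := by rw [mirrorFor, if_neg hH, if_pos hV]
    have horb := h.reflect (j := j) (d := S (a j)) (μ := mirror₂)
      (ρ := fun z => -(starRingEnd ℂ z)) (by simp)
      (fun z hz => by
        rw [mem_closedRegion_empty] at hz ⊢
        simpa using hz)
      (fun z c => by
        apply Complex.ext <;> simp [mirror₂, Complex.inv_re, Complex.inv_im] <;> ring)
      (by
        rw [hs, hS]
        apply Complex.ext
        · have := t2
          rw [Complex.sub_re, ← GaussianInt.intCast_re] at this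
          simp only [Complex.neg_re, Complex.conj_re, t2, Complex.sub_re, GaussianInt.re_toComplex]
          push_cast
          linarith
        · simp; ring)
    rw [← hM] at horb
    refine ⟨Or.inr hV, ⟨_, horb, by simp⟩, hadm _ horb (by simp) fun e he hen => ?_⟩
    by_contra! hpos
    have hpos' : 0 < (e * a j).re := by
      rcases unit_cases hen with rfl | rfl | rfl | rfl <;>
        simp [hS, Zsqrtd.re_mul] at hpos ⊢ <;> exact hpos
    rcases htie e he hen hpos' with ⟨-, -, s⟩ | ⟨s, -, -⟩
    · simp [hS, Zsqrtd.re_mul, s] at hpos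
    · omega
  · have hre := two_le_abs_re_of_tie hK h0 hu t1 t2
    have hH : IsHorizontal (a j) := ⟨hre, t1⟩
    have hS : S (a j) = ⟨(a j).re, 0⟩ := by rw [S, if_pos hH]
    have hM : mirrorFor (a j) = mirror₁ := by rw [mirrorFor, if_pos hH]
    have horb := h.reflect (j := j) (d := S (a j)) (μ := mirror₁)
      (ρ := fun z => starRingEnd ℂ z) (by simp)
      (fun z hz => by
        rw [mem_closedRegion_empty] at hz ⊢
        simpa using hz)
      (fun z c => by
        apply Complex.ext <;> simp [mirror₁, Complex.inv_re, Complex.inv_im])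
      (by
        rw [hs, hS]
        apply Complex.ext
        · simp
        · have := t2
          rw [Complex.sub_im, ← GaussianInt.intCast_im] at this
          simp only [Complex.conj_im, t2, Complex.sub_im, GaussianInt.im_toComplex]
          push_cast
          linarith)
    rw [← hM] at horb
    refine ⟨Or.inl hH, ⟨_, horb, by simp⟩, hadm _ horb (by simp) fun e he hen => ?_⟩
    by_contra! hpos
    have hpos' : 0 < (e * a j).re := by
      rcases unit_cases hen with rfl | rfl | rfl | rfl <;>
        simp [hS, Zsqrtd.re_mul] at hpos ⊢ <;> exact hpos
    rcases htie e he hen hpos' with ⟨s, -, -⟩ | ⟨-, -, s⟩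
    · omega
    · simp [hS, Zsqrtd.re_mul, s] at hpos

lemma IsBreak.not_allowed {a : ℕ → GaussianInt} {j : ℕ} (h : IsBreak a j) :
    Admissible ∅ a j ∧ ¬ Allowed (state ∅ a j) (a j) := by
  obtain ⟨-, h1, h2⟩ := h
  rw [regularWord_iff] at h1 h2
  exact ⟨h1, fun h => h2 (admissible_succ'.2 ⟨h1, h⟩)⟩

lemma IsOrbit.admissible_one {a : ℕ → GaussianInt} {ζ : ℕ → ℂ} (h : IsOrbit a ζ) :
    Admissible ∅ a 1 := by
  refine admissible_succ.2 ⟨?_, fun k hk => absurd hk k.not_lt_zero⟩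
  have hu : (ζ 0)⁻¹ - a 0 ∈ closedRegion ∅ := (h 0).2.2 ▸ (h 1).2.1
  obtain ⟨h1, h2⟩ := digit_conditions (h 0).2.1 (h 0).1 hu
  exact ⟨h1, h2, by simp⟩

lemma IsOrbit.admissible_of_no_break {a : ℕ → GaussianInt} {ζ : ℕ → ℂ} (h : IsOrbit a ζ)
    (hno : ¬ ∃ j, IsBreak a j) (n : ℕ) : Admissible ∅ a n := by
  induction n with
  | zero => exact fun k hk => absurd hk k.not_lt_zero
  | succ n ih =>
    rcases Nat.eq_zero_or_pos n with rfl | hn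
    · exact h.admissible_one
    · by_contra hcon
      exact hno ⟨n, hn, regularWord_iff.2 ih, fun hr => hcon (regularWord_iff.1 hr)⟩

open Classical in
/-- One iteration of the algorithm moves the first break to the right and changes nothing to the
left of it. -/
lemma algStep_spec {a : ℕ → GaussianInt} {ζ : ℕ → ℂ} (h : IsOrbit a ζ) {n : ℕ}
    (ha : Admissible ∅ a n) : (∃ ξ, IsOrbit (algStep a) ξ ∧ ξ 0 = ζ 0) ∧
      Admissible ∅ (algStep a) (n + 1) ∧ ∀ k < n, algStep a k = a k := by
  by_cases hb : ∃ j, IsBreak a j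
  · have hstep : algStep a = correctAt a (Nat.find hb) := dif_pos hb
    obtain ⟨b1, b2⟩ := (Nat.find_spec hb).not_allowed
    obtain ⟨-, horb, hadm⟩ := correctAt_spec h b1 b2
    have hle : n ≤ Nat.find hb := by
      by_contra! hlt
      exact b2 (ha _ hlt)
    rw [hstep]
    exact ⟨horb, hadm.mono (by omega), fun k hk => if_pos (by omega)⟩
  · have hstep : algStep a = a := dif_neg hb
    rw [hstep]
    exact ⟨⟨ζ, h, rfl⟩, h.admissible_of_no_break hb _, fun _ _ => rfl⟩

lemma algIter_succ (a : ℕ → GaussianInt) (N : ℕ) : algIter a (N + 1) = algStep (algIter a N) :=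
  Function.iterate_succ_apply' _ _ _

lemma algIter_spec {a : ℕ → GaussianInt} {ζ : ℕ → ℂ} (h : IsOrbit a ζ) (N : ℕ) :
    (∃ ξ, IsOrbit (algIter a N) ξ ∧ ξ 0 = ζ 0) ∧ Admissible ∅ (algIter a N) N := by
  induction N with
  | zero => exact ⟨⟨ζ, h, rfl⟩, fun k hk => absurd hk k.not_lt_zero⟩
  | succ N ih =>
    obtain ⟨⟨ξ, hξ, h0⟩, hadm⟩ := ih
    obtain ⟨⟨ξ', hξ', h0'⟩, hadm', -⟩ := algStep_spec hξ hadm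
    rw [algIter_succ]
    exact ⟨⟨ξ', hξ', h0'.trans h0⟩, hadm'⟩

lemma algIter_eq {a : ℕ → GaussianInt} {ζ : ℕ → ℂ} (h : IsOrbit a ζ) {k N : ℕ} (hk : k < N) :
    algIter a N k = algIter a (k + 1) k := by
  induction N, hk using Nat.le_induction with
  | base => rfl
  | succ N hN ih =>
    obtain ⟨⟨ξ, hξ, -⟩, hadm⟩ := algIter_spec h N
    rw [algIter_succ, (algStep_spec hξ hadm).2.2 k hN, ih]

/-- The algorithm applied to the digits of any orbit. -/
theorem algorithm_spec {a : ℕ → GaussianInt} {ζ : ℕ → ℂ} (h : IsOrbit a ζ) :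
    (∀ N j, IsBreak (algIter a N) j →
      IsHorizontal (algIter a N j) ∨ IsVertical (algIter a N j)) ∧
    ∃ b ∈ Rbar, (∀ k, ∀ᶠ N in atTop, algIter a N k = b k) ∧ LambdaBar b = ζ 0 := by
  refine ⟨fun N j hb => ?_, fun k => algIter a (k + 1) k, ?_, fun k => ?_, ?_⟩
  · obtain ⟨⟨ξ, hξ, -⟩, -⟩ := algIter_spec h N
    exact (correctAt_spec hξ hb.not_allowed.1 hb.not_allowed.2).1
  · exact mem_Rbar_iff.2 fun n => (algIter_spec h n).2.congr fun k hk => algIter_eq h hk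
  · filter_upwards [eventually_gt_atTop k] with N hN
    exact algIter_eq h hN
  · refine LambdaBar_eq (tendsto_convergent_of_norm_le fun n => ?_)
    obtain ⟨⟨ξ, hξ, h0⟩, hadm⟩ := algIter_spec h n
    rw [← convergent_congr fun k hk => algIter_eq h hk, ← h0]
    exact hξ.norm_sub_convergent_le (Set.notMem_empty _) hadm

end HurwitzCF

end

theorem theorem1p1 :
    -- the map `LambdaBar` is well defined on `Rbar`
    (∀ a ∈ HurwitzCF.Rbar,
      (∀ n : ℕ, HurwitzCF.CFDefined n (HurwitzCF.pref a n)) ∧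
      ∃ z : ℂ, Tendsto (HurwitzCF.convergent a) atTop (𝓝 z)) ∧
    -- its image is the closed square without the Gaussian rationals
    HurwitzCF.LambdaBar '' HurwitzCF.Rbar =
      closure HurwitzCF.square \ HurwitzCF.gaussianRationals ∧
    -- the algorithm turns an irregular Hurwitz expansion of `z` into an element of `Rbar` of value `z`
    (∀ z ∈ HurwitzCF.square \ HurwitzCF.gaussianRationals,
      (∃ n : ℕ, 1 ≤ n ∧
        HurwitzCF.IrregularWord (HurwitzCF.pref (HurwitzCF.partialQuotient z) n)) →
      (∀ N j : ℕ,
        HurwitzCF.IsBreak (HurwitzCF.algIter (HurwitzCF.partialQuotient z) N) j →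
        HurwitzCF.IsHorizontal (HurwitzCF.algIter (HurwitzCF.partialQuotient z) N j) ∨
        HurwitzCF.IsVertical (HurwitzCF.algIter (HurwitzCF.partialQuotient z) N j)) ∧
      ∃ b ∈ HurwitzCF.Rbar,
        (∀ k : ℕ, ∀ᶠ N in atTop,
          HurwitzCF.algIter (HurwitzCF.partialQuotient z) N k = b k) ∧
        HurwitzCF.LambdaBar b = z) := by
  refine ⟨fun a ha => ?_, HurwitzCF.LambdaBar_image, fun z hz _ => ?_⟩
  · rw [HurwitzCF.mem_Rbar_iff] at ha
    exact ⟨fun n => HurwitzCF.cfDefined_pref (ha n),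
      HurwitzCF.exists_tendsto_convergent (Set.notMem_empty _) ha⟩
  · exact HurwitzCF.algorithm_spec (HurwitzCF.isOrbit_gauss hz.1 hz.2)
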